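/- Let $\gamma\in(0,1)$ and let $(\alpha_n)_{n\ge 0}$ be a sequence in the open unit disk $\mathbb D$ with infinitely many non-zero terms and $$\sum_{n=0}^\infty n^\gamma|\alpha_n|^2<\infty .$$ For $\beta\in[0,2\pi)$ let $\Phi_n(\cdot,\beta)$ be the monic polynomials with Verblunsky coefficients $e^{i\beta}\alpha_n$, that is, $\Phi_0(z,\beta)=1$ and $$\Phi_{n+1}(z,\beta)=z\,\Phi_n(z,\beta)-\overline{e^{i\beta}\alpha_n}\,\Phi_n^*(z,\beta),\qquad \Phi_n^*(z,\beta)=z^n\,\overline{\Phi_n(1/\overline z,\beta)},$$ and let $R_n(\eta,\beta)=|\Phi_n(e^{i\eta},\beta)|$ be the Prüfer radius. Define $x_0=0$ and, for $n\ge 0$, let $x_{n+1}$ be the smallest power of $2$ (with $1=2^0$ counted as a power of $2$) such that $x_{n+1}>x_n$ and $\alpha_j\ne 0$ for at least one integer $j\in[x_n,x_{n+1})$. Let $\nu$ be a finite Borel measure on $(0,2\pi)$ such that (i) there is $\delta>0$ such that $\nu$ is supported by $(\delta,2\pi-\delta)$, i.e. the complement of this interval is $\nu$-null; (ii) there are $D\in(1-\gamma,1)$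 and $C<\infty$ such that $\nu(I)\le C|I|^D$ for every interval $I\subseteq(0,2\pi)$. Then, for $\nu$-almost every $\eta$, $$\sup\{R_{x_n}(\eta,\beta):\ \beta\in[0,2\pi),\ n\in\mathbb Z_{\ge 0}\}<\infty .$$ -/

import Mathlib

namespace OPUC

/-- The Szegő dual at degree `n`: for `P` of degree at most `n` this is the polynomial
`z ^ n * conj (P (1 / conj z))`. -/
noncomputable def szegoDual (n : ℕ) (P : Polynomial ℂ) : Polynomial ℂ :=
  (P.map (starRingEnd ℂ)).reflect n

/-- The monic orthogonal polynomials with Verblunsky coefficients `a`, through the Szegő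
recurrence `Φ_{n+1}(z) = z Φ_n(z) - conj (a_n) Φ_n^*(z)`, `Φ_0 = 1`. -/
noncomputable def monicOPUC (a : ℕ → ℂ) : ℕ → Polynomial ℂ
  | 0 => 1
  | n + 1 =>
      Polynomial.X * monicOPUC a n
        - Polynomial.C (starRingEnd ℂ (a n)) * szegoDual n (monicOPUC a n)

/-- The monic polynomials `Φ_n(·, β)`, with Verblunsky coefficients `e^{iβ} α_n`. -/
noncomputable def monicOPUCPhase (α : ℕ → ℂ) (β : ℝ) (n : ℕ) : Polynomial ℂ :=
  monicOPUC (fun k => Complex.exp (Complex.I * β) * α k) n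

/-- The Prüfer radius `R_n(η, β)`. In the polar form
`Φ_n(e^{iη}, β) = R_n(η, β) exp (i (n η + θ_n(η, β)))` with `θ_n` real and `R_n > 0`,
it is the modulus of the left-hand side. -/
noncomputable def pruferRadius (α : ℕ → ℂ) (n : ℕ) (η β : ℝ) : ℝ :=
  ‖(monicOPUCPhase α β n).eval (Complex.exp (Complex.I * η))‖

/-- The admissible right endpoints for a block starting at `x`: powers of two `m > x` such that
`α j ≠ 0` for at least one `j ∈ [x, m)`. -/
def blockCandidates (α : ℕ → ℂ) (x : ℕ) : Set ℕ :=
  {m | (∃ k : ℕ, m = 2 ^ k) ∧ x < m ∧ ∃ j ∈ Set.Ico x m, α j ≠ 0}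

/-- The dyadic block endpoints: `x_0 = 0`, and `x_{n+1}` is the smallest power of two
`m > x_n` such that `α j ≠ 0` for at least one `j ∈ [x_n, m)`. -/
noncomputable def blockEndpoint (α : ℕ → ℂ) : ℕ → ℕ
  | 0 => 0
  | n + 1 => sInf (blockCandidates α (blockEndpoint α n))

/-- If `α` is not finitely supported, the minimum defining `blockEndpoint` is attained. -/
theorem blockEndpoint_isLeast (α : ℕ → ℂ) (hα : {n | α n ≠ 0}.Infinite) (n : ℕ) :
    IsLeast (blockCandidates α (blockEndpoint α n)) (blockEndpoint α (n + 1)) := by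
  have hne : (blockCandidates α (blockEndpoint α n)).Nonempty := by
    obtain ⟨j, hj, hjx⟩ := hα.exists_gt (blockEndpoint α n)
    have h2 : j < 2 ^ j := Nat.lt_two_pow_self
    exact ⟨2 ^ j, ⟨j, rfl⟩, hjx.trans h2, j, ⟨hjx.le, h2⟩, hj⟩
  exact ⟨Nat.sInf_mem hne, fun m hm => Nat.sInf_le hm⟩

end OPUC

/-!
On the unit circle, `v_n = e^{iβ/2} e^{-inη} Φ_n(e^{iη}, β)` satisfies `v_{n+1} = (1 + B_n) v_n` and
`v_0 = e^{iβ/2}`, where `B_n v = -conj (α_n e^{i(n+1)η} v)` is real-linear and independent of `β`.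
Hence `R_n(η, β)` is at most the norm of the ordered product `(1 + B_{n-1}) ⋯ (1 + B_0)`, for all
`β` simultaneously.

By induction on the length of a dyadic block, the ordered product over it differs from
`1 + ∑ B_j` by at most a constant times the sum of `‖∑_{j ∈ I} B_j‖²` over its dyadic subintervals
`I`, as long as this energy is small. Here `‖∑_{j ∈ I} B_j‖` is the modulus of a trigonometric
polynomial with coefficients `α_j`, so Gallagher's large sieve argument, Parseval's identity and the
Hölder bound on `ν` show that the energy of `[2^k, 2^{k+1})` has `ν`-integral at most
`C (k + 1) 2^{k(1-D)} ∑ |α_j|²`, summed over the block. As `γ > 1 - D`, Cauchy–Schwarz makes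
`∑_k (k + 1) √(energy of block k)` finite almost everywhere, which bounds all ordered products.
-/

namespace OPUC

section OrderedProduct

open Finset

/-- The ordered product `(1 + B (s + n - 1)) * ⋯ * (1 + B s)`, i.e. the transfer operator of the
recurrence `v (k + 1) = (1 + B k) * v k` from time `s` to time `s + n`. -/
def orderedProd {𝔸 : Type*} [Ring 𝔸] (B : ℕ → 𝔸) (s : ℕ) : ℕ → 𝔸
  | 0 => 1
  | n + 1 => (1 + B (s + n)) * orderedProd B s n

/-- The sum of `‖∑ i ∈ I, B i‖ ^ 2` over all dyadic subintervals `I` of `[s, s + 2 ^ m)`, that is,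
over the intervals obtained from it by repeated halving, itself and the singletons included. -/
def dyadicEnergy {M : Type*} [SeminormedAddCommGroup M] (B : ℕ → M) : ℕ → ℕ → ℝ
  | 0, s => ‖B s‖ ^ 2
  | m + 1, s => ‖∑ i ∈ Ico s (s + 2 ^ (m + 1)), B i‖ ^ 2
      + (dyadicEnergy B m s + dyadicEnergy B m (s + 2 ^ m))

theorem sum_Ico_two_pow_succ {M : Type*} [AddCommMonoid M] (B : ℕ → M) (s m : ℕ) :
    ∑ i ∈ Ico s (s + 2 ^ (m + 1)), B i
      = ∑ i ∈ Ico s (s + 2 ^ m), B i + ∑ i ∈ Ico (s + 2 ^ m) (s + 2 ^ m + 2 ^ m), B i := by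
  rw [sum_Ico_consecutive _ (Nat.le_add_right _ _) (Nat.le_add_right _ _), add_assoc, pow_succ,
    mul_two]

theorem orderedProd_add {𝔸 : Type*} [Ring 𝔸] (B : ℕ → 𝔸) (s m n : ℕ) :
    orderedProd B s (m + n) = orderedProd B (s + m) n * orderedProd B s m := by
  induction n with
  | zero => simp [orderedProd]
  | succ n ih => rw [← add_assoc, orderedProd, ih, orderedProd, mul_assoc, add_assoc]

theorem orderedProd_two_pow_succ {𝔸 : Type*} [Ring 𝔸] (B : ℕ → 𝔸) (s m : ℕ) :
    orderedProd B s (2 ^ (m + 1))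
      = orderedProd B (s + 2 ^ m) (2 ^ m) * orderedProd B s (2 ^ m) := by
  rw [pow_succ, mul_two, orderedProd_add]

section Energy

variable {M : Type*} [SeminormedAddCommGroup M] (B : ℕ → M) (m s : ℕ)

theorem dyadicEnergy_nonneg : 0 ≤ dyadicEnergy B m s := by
  induction m generalizing s with
  | zero => exact sq_nonneg _
  | succ m ih => exact add_nonneg (sq_nonneg _) (add_nonneg (ih _) (ih _))

theorem dyadicEnergy_left_le_succ : dyadicEnergy B m s ≤ dyadicEnergy B (m + 1) s := by
  rw [dyadicEnergy]
  linarith [sq_nonneg ‖∑ i ∈ Ico s (s + 2 ^ (m + 1)), B i‖, dyadicEnergy_nonneg B m (s + 2 ^ m)]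

theorem dyadicEnergy_right_le_succ : dyadicEnergy B m (s + 2 ^ m) ≤ dyadicEnergy B (m + 1) s := by
  rw [dyadicEnergy]
  linarith [sq_nonneg ‖∑ i ∈ Ico s (s + 2 ^ (m + 1)), B i‖, dyadicEnergy_nonneg B m s]

end Energy

variable {𝔸 : Type*} [NormedRing 𝔸]

theorem norm_mul_sub_one_sub_add_le {p p' a a' : 𝔸} {ε : ℝ} (hp : ‖p - 1 - a‖ ≤ ε)
    (hp' : ‖p' - 1 - a'‖ ≤ ε) :
    ‖p' * p - 1 - (a + a')‖
      ≤ (1 + ε) * (‖p - 1 - a‖ + ‖a‖ ^ 2 + (‖p' - 1 - a'‖ + ‖a'‖ ^ 2)) := by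
  have expand : p' * p - 1 - (a + a')
      = (p - 1 - a) + (p' - 1 - a') + (a' + (p' - 1 - a')) * (a + (p - 1 - a)) := by noncomm_ring
  rw [expand]
  generalize p - 1 - a = w at *
  generalize p' - 1 - a' = w' at *
  have hε : 0 ≤ ε := (norm_nonneg w).trans hp
  have am_gm : (‖a'‖ + ‖w'‖) * (‖a‖ + ‖w‖) ≤ ‖a‖ ^ 2 + ‖a'‖ ^ 2 + (‖w‖ ^ 2 + ‖w'‖ ^ 2) := by
    linarith [two_mul_le_add_sq (‖a'‖ + ‖w'‖) (‖a‖ + ‖w‖), add_sq_le (a := ‖a'‖) (b := ‖w'‖),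
      add_sq_le (a := ‖a‖) (b := ‖w‖)]
  calc ‖w + w' + (a' + w') * (a + w)‖
      ≤ ‖w‖ + ‖w'‖ + (‖a'‖ + ‖w'‖) * (‖a‖ + ‖w‖) := by
        grw [norm_add_le, norm_mul_le, norm_add_le w w', norm_add_le a' w', norm_add_le a w]
    _ ≤ ‖w‖ + ‖w'‖ + (‖a‖ ^ 2 + ‖a'‖ ^ 2 + (ε * ‖w‖ + ε * ‖w'‖)) := by
        grw [am_gm, sq ‖w‖, sq ‖w'‖, mul_le_mul_of_nonneg_right hp (norm_nonneg w),
          mul_le_mul_of_nonneg_right hp' (norm_nonneg w')]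
    _ ≤ (1 + ε) * (‖w‖ + ‖a‖ ^ 2 + (‖w'‖ + ‖a'‖ ^ 2)) := by
        linarith [mul_nonneg hε (add_nonneg (sq_nonneg ‖a‖) (sq_nonneg ‖a'‖))]

/-- Keeping `‖∑ B‖ ^ 2` on the left makes the induction close: it absorbs the cross terms that
arise when two halves are multiplied. -/
theorem norm_orderedProd_sub_linearization_add_sq_le (B : ℕ → 𝔸) {ε : ℝ} (hε : 0 ≤ ε) (m s : ℕ)
    (h : (1 + ε) ^ m * dyadicEnergy B m s ≤ ε) :
    ‖orderedProd B s (2 ^ m) - 1 - ∑ i ∈ Ico s (s + 2 ^ m), B i‖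
        + ‖∑ i ∈ Ico s (s + 2 ^ m), B i‖ ^ 2
      ≤ (1 + ε) ^ m * dyadicEnergy B m s := by
  induction m generalizing s with
  | zero => simp [orderedProd, dyadicEnergy]
  | succ m ih =>
    have hpow : (1 + ε) ^ m ≤ (1 + ε) ^ (m + 1) := pow_le_pow_right₀ (by linarith) m.le_succ
    have small_of_le {e : ℝ} (he₀ : 0 ≤ e) (he : e ≤ dyadicEnergy B (m + 1) s) :
        (1 + ε) ^ m * e ≤ ε :=
      (mul_le_mul hpow he he₀ (by positivity)).trans h
    have hleft := small_of_le (dyadicEnergy_nonneg B m s) (dyadicEnergy_left_le_succ B m s)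
    have hright := small_of_le (dyadicEnergy_nonneg B m _) (dyadicEnergy_right_le_succ B m s)
    have hmul := norm_mul_sub_one_sub_add_le
      ((le_add_of_nonneg_right (sq_nonneg _)).trans ((ih s hleft).trans hleft))
      ((le_add_of_nonneg_right (sq_nonneg _)).trans ((ih _ hright).trans hright))
    rw [← orderedProd_two_pow_succ, ← sum_Ico_two_pow_succ] at hmul
    have hone : 1 ≤ (1 + ε) ^ (m + 1) := one_le_pow₀ (by linarith)
    calc ‖orderedProd B s (2 ^ (m + 1)) - 1 - ∑ i ∈ Ico s (s + 2 ^ (m + 1)), B i‖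
          + ‖∑ i ∈ Ico s (s + 2 ^ (m + 1)), B i‖ ^ 2
        ≤ (1 + ε) * ((1 + ε) ^ m * dyadicEnergy B m s
            + (1 + ε) ^ m * dyadicEnergy B m (s + 2 ^ m))
          + (1 + ε) ^ (m + 1) * ‖∑ i ∈ Ico s (s + 2 ^ (m + 1)), B i‖ ^ 2 := by
          grw [hmul, ih s hleft, ih _ hright, ← le_mul_of_one_le_left (sq_nonneg _) hone]
      _ = (1 + ε) ^ (m + 1) * dyadicEnergy B (m + 1) s := by rw [dyadicEnergy]; ring

theorem one_add_inv_pow_le_three (m : ℕ) : (1 + ((m : ℝ) + 1)⁻¹) ^ m ≤ 3 := by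
  have hm : m * ((m : ℝ) + 1)⁻¹ ≤ 1 := by
    rw [← div_eq_mul_inv, div_le_one (by positivity)]
    linarith
  calc (1 + ((m : ℝ) + 1)⁻¹) ^ m ≤ Real.exp ((m : ℝ) + 1)⁻¹ ^ m := by
        gcongr
        linarith [Real.add_one_le_exp ((m : ℝ) + 1)⁻¹]
    _ = Real.exp (m * ((m : ℝ) + 1)⁻¹) := (Real.exp_nat_mul _ _).symm
    _ ≤ Real.exp 1 := Real.exp_le_exp.2 hm
    _ ≤ 3 := Real.exp_one_lt_three.le

theorem norm_orderedProd_sub_one_sq_le (B : ℕ → 𝔸) (m s : ℕ)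
    (h : 3 * dyadicEnergy B m s ≤ ((m : ℝ) + 1)⁻¹) :
    ‖orderedProd B s (2 ^ m) - 1‖ ^ 2 ≤ 6 * dyadicEnergy B m s := by
  have hpow := mul_le_mul_of_nonneg_right (one_add_inv_pow_le_three m) (dyadicEnergy_nonneg B m s)
  have hlin := (norm_orderedProd_sub_linearization_add_sq_le B (by positivity) m s
    (hpow.trans h)).trans hpow
  have htri := norm_add_le (orderedProd B s (2 ^ m) - 1 - ∑ i ∈ Ico s (s + 2 ^ m), B i)
    (∑ i ∈ Ico s (s + 2 ^ m), B i)
  rw [sub_add_cancel] at htri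
  set S := ‖∑ i ∈ Ico s (s + 2 ^ m), B i‖
  set w := ‖orderedProd B s (2 ^ m) - 1 - ∑ i ∈ Ico s (s + 2 ^ m), B i‖
  have hw₀ : 0 ≤ w := norm_nonneg _
  have hm : ((m : ℝ) + 1)⁻¹ ≤ 1 := inv_le_one_of_one_le₀ (by linarith [Nat.cast_nonneg (α := ℝ) m])
  calc ‖orderedProd B s (2 ^ m) - 1‖ ^ 2 ≤ (w + S) ^ 2 := by gcongr
    _ ≤ 2 * (w ^ 2 + S ^ 2) := add_sq_le
    _ ≤ 2 * (w + S ^ 2) := by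
        gcongr
        exact pow_le_of_le_one hw₀ (by linarith [sq_nonneg S]) two_ne_zero
    _ ≤ 6 * dyadicEnergy B m s := by linarith

theorem bddAbove_norm_orderedProd_of_dyadic (B : ℕ → 𝔸) {f : ℕ → ℝ} (hf₀ : ∀ k, 0 ≤ f k)
    (hf : Summable f)
    (h : ∀ᶠ k in Filter.atTop, ∀ j ≤ 2 ^ k, ‖orderedProd B (2 ^ k) j‖ ≤ Real.exp (f k)) :
    BddAbove (Set.range fun n => ‖orderedProd B 0 n‖) := by
  obtain ⟨k₀, hk₀⟩ := Filter.eventually_atTop.1 h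
  obtain ⟨C, hC⟩ := ((Set.finite_Iic (2 ^ k₀)).image fun n => ‖orderedProd B 0 n‖).bddAbove
  replace hC (n : ℕ) (hn : n ≤ 2 ^ k₀) : ‖orderedProd B 0 n‖ ≤ C := hC ⟨n, hn, rfl⟩
  have hC₀ : 0 ≤ C := (norm_nonneg _).trans (hC 0 (Nat.zero_le _))
  have blocks (d : ℕ) : ∀ n ≤ 2 ^ (k₀ + d),
      ‖orderedProd B 0 n‖ ≤ Real.exp (∑ i ∈ range d, f (k₀ + i)) * C := by
    induction d with
    | zero => simpa using hC
    | succ d ih =>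
      intro n hn
      rw [sum_range_succ, add_comm, Real.exp_add, mul_assoc]
      rcases le_total n (2 ^ (k₀ + d)) with hn' | hn'
      · exact (ih n hn').trans (le_mul_of_one_le_left (by positivity) (Real.one_le_exp (hf₀ _)))
      · obtain ⟨j, rfl⟩ := Nat.exists_eq_add_of_le hn'
        have hj : j ≤ 2 ^ (k₀ + d) := by rw [← add_assoc, pow_succ] at hn; omega
        rw [orderedProd_add, zero_add]
        grw [norm_mul_le, hk₀ _ (Nat.le_add_right _ _) j hj, ih _ le_rfl]
  refine ⟨Real.exp (∑' i, f (k₀ + i)) * C, ?_⟩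
  rintro _ ⟨n, rfl⟩
  have hn : n ≤ 2 ^ (k₀ + n) :=
    Nat.lt_two_pow_self.le.trans (Nat.pow_le_pow_right two_pos (Nat.le_add_left _ _))
  refine (blocks n n hn).trans ?_
  gcongr
  exact (hf.comp_injective (add_right_injective k₀)).sum_le_tsum _ fun i _ => hf₀ _

variable [NormOneClass 𝔸]

theorem norm_orderedProd_two_pow_le_exp (B : ℕ → 𝔸) (m s : ℕ)
    (h : 3 * dyadicEnergy B m s ≤ ((m : ℝ) + 1)⁻¹) :
    ‖orderedProd B s (2 ^ m)‖ ≤ Real.exp √(6 * dyadicEnergy B m s) := by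
  have hsub : ‖orderedProd B s (2 ^ m) - 1‖ ≤ √(6 * dyadicEnergy B m s) :=
    Real.le_sqrt_of_sq_le (norm_orderedProd_sub_one_sq_le B m s h)
  have htri := norm_add_le (orderedProd B s (2 ^ m) - 1) 1
  rw [sub_add_cancel, norm_one] at htri
  linarith [Real.add_one_le_exp √(6 * dyadicEnergy B m s)]

/-- The interval `[s, s + j)` is a disjoint union of at most `m + 1` dyadic subintervals of
`[s, s + 2 ^ m)`, each of which contributes a factor `exp √(6 * dyadicEnergy B m s)`. -/
theorem norm_orderedProd_le_exp (B : ℕ → 𝔸) (m s : ℕ)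
    (h : 3 * dyadicEnergy B m s ≤ ((m : ℝ) + 1)⁻¹) {j : ℕ} (hj : j ≤ 2 ^ m) :
    ‖orderedProd B s j‖ ≤ Real.exp ((m + 1) * √(6 * dyadicEnergy B m s)) := by
  induction m generalizing s j with
  | zero =>
    obtain rfl | rfl : j = 0 ∨ j = 1 := by rw [pow_zero] at hj; omega
    · rw [orderedProd, norm_one]
      exact Real.one_le_exp (by positivity)
    · simpa using norm_orderedProd_two_pow_le_exp B 0 s h
  | succ m ih =>
    have hle : 3 * dyadicEnergy B (m + 1) s ≤ ((m : ℝ) + 1)⁻¹ := by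
      refine h.trans ?_
      gcongr
      simp
    have hl := dyadicEnergy_left_le_succ B m s
    have hr := dyadicEnergy_right_le_succ B m s
    have hleft : 3 * dyadicEnergy B m s ≤ ((m : ℝ) + 1)⁻¹ := by linarith
    have hright : 3 * dyadicEnergy B m (s + 2 ^ m) ≤ ((m : ℝ) + 1)⁻¹ := by linarith
    push_cast
    rcases le_total j (2 ^ m) with hj' | hj'
    · refine (ih s hleft hj').trans ?_
      gcongr
      linarith
    · obtain ⟨i, rfl⟩ := Nat.exists_eq_add_of_le hj'
      have hi : i ≤ 2 ^ m := by rw [pow_succ] at hj; omega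
      rw [orderedProd_add, add_mul _ 1, one_mul, Real.exp_add]
      grw [norm_mul_le, ih _ hright hi, norm_orderedProd_two_pow_le_exp B m s hleft, hl, hr]

theorem bddAbove_norm_orderedProd (B : ℕ → 𝔸)
    (h : Summable fun k : ℕ => ((k : ℝ) + 1) * √(dyadicEnergy B k (2 ^ k))) :
    BddAbove (Set.range fun n => ‖orderedProd B 0 n‖) := by
  have hsum : Summable fun k : ℕ => ((k : ℝ) + 1) * √(6 * dyadicEnergy B k (2 ^ k)) :=
    (h.mul_left √6).congr fun k => by rw [Real.sqrt_mul (by norm_num)]; ring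
  refine bddAbove_norm_orderedProd_of_dyadic B (fun k => by positivity) hsum ?_
  filter_upwards [h.tendsto_atTop_zero.eventually_le_const (by norm_num : (0 : ℝ) < 1 / 3)]
    with k hk j hj
  refine norm_orderedProd_le_exp B k _ ?_ hj
  have hE := Real.sq_sqrt (dyadicEnergy_nonneg B k (2 ^ k))
  have hsqrt := Real.sqrt_nonneg (dyadicEnergy B k (2 ^ k))
  have hk₁ : 1 ≤ (k : ℝ) + 1 := le_add_of_nonneg_left k.cast_nonneg
  rw [← one_div, le_div_iff₀ (by positivity)]
  nlinarith [hk₁]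

end OrderedProduct

section EnergyIntegral

open Finset MeasureTheory

open scoped ENNReal

variable {X M : Type*} [MeasurableSpace X] [SeminormedAddCommGroup M] {B : X → ℕ → M}

theorem measurable_dyadicEnergy (hB : ∀ n, StronglyMeasurable fun x => B x n) (m s : ℕ) :
    Measurable fun x => dyadicEnergy (B x) m s := by
  induction m generalizing s with
  | zero => exact (hB s).norm.measurable.pow_const 2
  | succ m ih =>
    refine Measurable.add ?_ ((ih s).add (ih _))
    exact ((Finset.stronglyMeasurable_fun_sum _ fun i _ => hB i).norm.measurable).pow_const 2

theorem lintegral_dyadicEnergy_le {μ : Measure X} (hB : ∀ n, StronglyMeasurable fun x => B x n)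
    {A : ℝ≥0∞} {w : ℕ → ℝ≥0∞} (m : ℕ)
    (h : ∀ i ≤ m, ∀ s, ∫⁻ x, ‖∑ j ∈ Ico s (s + 2 ^ i), B x j‖ₑ ^ 2 ∂μ
      ≤ A * ∑ j ∈ Ico s (s + 2 ^ i), w j) (s : ℕ) :
    ∫⁻ x, ENNReal.ofReal (dyadicEnergy (B x) m s) ∂μ
      ≤ (m + 1) * (A * ∑ j ∈ Ico s (s + 2 ^ m), w j) := by
  have ofReal_norm_sq (v : M) : ENNReal.ofReal (‖v‖ ^ 2) = ‖v‖ₑ ^ 2 := by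
    rw [ENNReal.ofReal_pow (norm_nonneg v), ofReal_norm]
  induction m generalizing s with
  | zero => simpa [dyadicEnergy, ofReal_norm_sq] using h 0 le_rfl s
  | succ m ih =>
    have hmeas (t : ℕ) : Measurable fun x => ENNReal.ofReal (dyadicEnergy (B x) m t) :=
      (measurable_dyadicEnergy hB m t).ennreal_ofReal
    have halves := ih fun i hi => h i (hi.trans m.le_succ)
    have split (x : X) : ENNReal.ofReal (dyadicEnergy (B x) (m + 1) s)
        = ‖∑ j ∈ Ico s (s + 2 ^ (m + 1)), B x j‖ₑ ^ 2
          + (ENNReal.ofReal (dyadicEnergy (B x) m s)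
            + ENNReal.ofReal (dyadicEnergy (B x) m (s + 2 ^ m))) := by
      have hl := dyadicEnergy_nonneg (B x) m s
      have hr := dyadicEnergy_nonneg (B x) m (s + 2 ^ m)
      rw [dyadicEnergy, ENNReal.ofReal_add (sq_nonneg _) (add_nonneg hl hr),
        ENNReal.ofReal_add hl hr, ofReal_norm_sq]
    simp only [split]
    rw [lintegral_add_right _ (by fun_prop), lintegral_add_left (hmeas s)]
    grw [h (m + 1) le_rfl s, halves s, halves (s + 2 ^ m), sum_Ico_two_pow_succ]
    push_cast
    exact le_of_eq (by ring)

end EnergyIntegral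

section Prufer

open Polynomial

open scoped ComplexConjugate

theorem natDegree_szegoDual_le {n : ℕ} {P : ℂ[X]} (hP : P.natDegree ≤ n) :
    (szegoDual n P).natDegree ≤ n :=
  natDegree_reflect_le.trans (max_le le_rfl (natDegree_map_le.trans hP))

theorem natDegree_monicOPUC_le (a : ℕ → ℂ) (n : ℕ) : (monicOPUC a n).natDegree ≤ n := by
  induction n with
  | zero => simp [monicOPUC]
  | succ n ih =>
    refine (natDegree_sub_le _ _).trans (max_le ?_ ?_)
    · exact natDegree_mul_le.trans (by rw [natDegree_X]; omega)
    · exact (natDegree_C_mul_le _ _).trans ((natDegree_szegoDual_le ih).trans n.le_succ)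

theorem eval_szegoDual {n : ℕ} {P : ℂ[X]} (hP : P.natDegree ≤ n) {z : ℂ} (hz : ‖z‖ = 1) :
    (szegoDual n P).eval z = z ^ n * conj (P.eval z) := by
  have hz₀ : z ≠ 0 := norm_ne_zero_iff.1 (hz ▸ one_ne_zero)
  let _ : Invertible z⁻¹ := invertibleOfNonzero (inv_ne_zero hz₀)
  have hreflect := eval₂_reflect_mul_pow (RingHom.id ℂ) z⁻¹ n (P.map (starRingEnd ℂ))
    (natDegree_map_le.trans hP)
  have hconj : conj (P.eval z) = (P.map (starRingEnd ℂ)).eval z⁻¹ := by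
    rw [Complex.inv_eq_conj hz, eval_map, eval₂_hom]
  rw [invOf_eq_inv, inv_inv, eval₂_id, eval₂_id, ← hconj] at hreflect
  rw [szegoDual, ← hreflect, mul_left_comm, ← mul_pow, mul_inv_cancel₀ hz₀, one_pow, mul_one]

theorem eval_monicOPUC_succ (a : ℕ → ℂ) (n : ℕ) {z : ℂ} (hz : ‖z‖ = 1) :
    (monicOPUC a (n + 1)).eval z
      = z * (monicOPUC a n).eval z - conj (a n) * (z ^ n * conj ((monicOPUC a n).eval z)) := by
  rw [monicOPUC, eval_sub, eval_mul, eval_X, eval_C_mul,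
    eval_szegoDual (natDegree_monicOPUC_le a n) hz]

/-- The increments `v ↦ -conj (α n * z ^ (n + 1) * v)` of the Szegő recurrence at a point `z` of
the unit circle, after the change of variables of `orderedProd_pruferStep_apply`. -/
noncomputable def pruferStep (α : ℕ → ℂ) (z : ℂ) (n : ℕ) : ℂ →L[ℝ] ℂ :=
  -conj (α n * z ^ (n + 1)) • (Complex.conjCLE : ℂ →L[ℝ] ℂ)

theorem norm_sum_pruferStep (α : ℕ → ℂ) (z : ℂ) (s : Finset ℕ) :
    ‖∑ i ∈ s, pruferStep α z i‖ = ‖∑ i ∈ s, α i * z ^ (i + 1)‖ := by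
  simp only [pruferStep]
  rw [← Finset.sum_smul, norm_smul, Complex.conjCLE_norm, mul_one, Finset.sum_neg_distrib, norm_neg,
    ← map_sum, Complex.norm_conj]

theorem orderedProd_pruferStep_apply (α : ℕ → ℂ) {z b : ℂ} (hz : ‖z‖ = 1) (hb : ‖b‖ = 1) (n : ℕ) :
    orderedProd (pruferStep α z) 0 n b
      = b * conj z ^ n * (monicOPUC (fun k => b ^ 2 * α k) n).eval z := by
  induction n with
  | zero => simp [orderedProd, monicOPUC]
  | succ n ih =>
    have hzz : z * conj z = 1 := by simp [Complex.mul_conj', hz]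
    have hbb : b * conj b = 1 := by simp [Complex.mul_conj', hb]
    have hstep : orderedProd (pruferStep α z) 0 (n + 1) b
        = orderedProd (pruferStep α z) 0 n b
          - conj (α n * z ^ (n + 1)) * conj (orderedProd (pruferStep α z) 0 n b) := by
      simp [orderedProd, pruferStep, sub_eq_add_neg]
    rw [hstep, ih, eval_monicOPUC_succ _ _ hz]
    simp only [map_mul, map_pow, Complex.conj_conj]
    generalize (monicOPUC (fun k => b ^ 2 * α k) n).eval z = Φ
    linear_combination (-b * conj z ^ n * Φ) * hzz
      + (conj (α n) * conj z ^ (n + 1) * z ^ n * conj b * conj Φ) * hbb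

theorem pruferRadius_le_norm_orderedProd (α : ℕ → ℂ) (n : ℕ) (η β : ℝ) :
    pruferRadius α n η β ≤ ‖orderedProd (pruferStep α (Complex.exp (Complex.I * η))) 0 n‖ := by
  have hz := Complex.norm_exp_I_mul_ofReal η
  have hb := Complex.norm_exp_I_mul_ofReal (β / 2)
  have hsq : Complex.exp (Complex.I * (β / 2 : ℝ)) ^ 2 = Complex.exp (Complex.I * β) := by
    rw [← Complex.exp_nat_mul]
    congr 1
    push_cast
    ring
  have h := (orderedProd (pruferStep α (Complex.exp (Complex.I * η))) 0 n).unit_le_opNorm _ hb.le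
  rw [orderedProd_pruferStep_apply α hz hb, norm_mul, norm_mul, norm_pow, Complex.norm_conj, hb, hz,
    one_pow, one_mul, one_mul, hsq] at h
  exact h

end Prufer

section Gallagher

open MeasureTheory Set

open scoped ENNReal

theorem le_average_add_integral_abs_deriv {F F' : ℝ → ℝ} {a b x : ℝ} (hab : a < b)
    (hx : x ∈ Icc a b) (hF : ∀ y, HasDerivAt F (F' y) y) (hF' : Continuous F') :
    F x ≤ (b - a)⁻¹ * (∫ y in a..b, F y) + ∫ y in a..b, |F' y| := by
  have oscillation_le : ∀ y ∈ Icc a b, F x - ∫ t in a..b, |F' t| ≤ F y := by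
    intro y hy
    have hFTC : ∫ t in y..x, F' t = F x - F y :=
      intervalIntegral.integral_eq_sub_of_hasDerivAt (fun t _ => hF t) (hF'.intervalIntegrable _ _)
    have habs :=
      calc |F x - F y|
        _ ≤ |(∫ t in y..x, |F' t|)| := by
          simpa only [← hFTC, Real.norm_eq_abs] using
            intervalIntegral.norm_integral_le_abs_integral_norm (f := F') (μ := volume)
        _ ≤ |(∫ t in a..b, |F' t|)| :=
          intervalIntegral.abs_integral_mono_interval
            (uIoc_subset_uIoc_of_uIcc_subset_uIcc
              (uIcc_subset_uIcc (Icc_subset_uIcc hy) (Icc_subset_uIcc hx)))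
            (ae_of_all _ fun t => abs_nonneg _) (hF'.abs.intervalIntegrable _ _)
        _ = ∫ t in a..b, |F' t| :=
          abs_of_nonneg (intervalIntegral.integral_nonneg hab.le fun t _ => abs_nonneg _)
    linarith [le_abs_self (F x - F y)]
  have hFc : Continuous F := continuous_iff_continuousAt.2 fun y => (hF y).continuousAt
  have hmean := intervalIntegral.integral_mono_on (μ := volume) hab.le intervalIntegrable_const
    (hFc.intervalIntegrable _ _) oscillation_le
  rw [intervalIntegral.integral_const, smul_eq_mul, ← le_inv_mul_iff₀ (sub_pos.2 hab)] at hmean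
  linarith

variable {E : Type*} [NormedAddCommGroup E] [InnerProductSpace ℝ E] {f f' : ℝ → E}

theorem norm_sq_le_integral (hf : ∀ y, HasDerivAt f (f' y) y) (hf' : Continuous f') {a b x : ℝ}
    (hab : a < b) (hx : x ∈ Icc a b) :
    ‖f x‖ ^ 2 ≤ ∫ y in a..b, (2 * (b - a)⁻¹ * ‖f y‖ ^ 2 + (b - a) * ‖f' y‖ ^ 2) := by
  have hfc : Continuous f := continuous_iff_continuousAt.2 fun y => (hf y).continuousAt
  have hlen : 0 < b - a := sub_pos.2 hab
  have am_gm (y : ℝ) :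
      |2 * inner ℝ (f y) (f' y)| ≤ (b - a)⁻¹ * ‖f y‖ ^ 2 + (b - a) * ‖f' y‖ ^ 2 := by
    have hsq : 0 ≤ (b - a)⁻¹ * (‖f y‖ - (b - a) * ‖f' y‖) ^ 2 := by positivity
    have hexpand : (b - a)⁻¹ * (‖f y‖ - (b - a) * ‖f' y‖) ^ 2
        = (b - a)⁻¹ * ‖f y‖ ^ 2 + (b - a) * ‖f' y‖ ^ 2 - 2 * (‖f y‖ * ‖f' y‖) := by
      field_simp
      ring
    rw [abs_mul, abs_two]
    linarith [abs_real_inner_le_norm (f y) (f' y)]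
  have hint {g : ℝ → ℝ} (hg : Continuous g) : IntervalIntegrable g volume a b :=
    hg.intervalIntegrable a b
  refine (le_average_add_integral_abs_deriv hab hx (fun y => (hf y).norm_sq) (by fun_prop)).trans ?_
  rw [← intervalIntegral.integral_const_mul,
    ← intervalIntegral.integral_add (hint (by fun_prop)) (hint (by fun_prop))]
  refine intervalIntegral.integral_mono_on hab.le (hint (by fun_prop)) (hint (by fun_prop))
    fun y _ => ?_
  linarith [am_gm y]

theorem setLIntegral_biUnion_le_mul {X ι : Type*} [MeasurableSpace X] {μ ν : Measure X}
    {t : Finset ι} {s : ι → Set X} (hs : ∀ i ∈ t, MeasurableSet (s i))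
    (hd : (t : Set ι).PairwiseDisjoint s) {g h : X → ℝ≥0∞} {M : ℝ≥0∞}
    (hM : ∀ i ∈ t, ν (s i) ≤ M) (hg : ∀ i ∈ t, ∀ x ∈ s i, g x ≤ ∫⁻ y in s i, h y ∂μ) :
    ∫⁻ x in ⋃ i ∈ t, s i, g x ∂ν ≤ M * ∫⁻ y in ⋃ i ∈ t, s i, h y ∂μ := by
  rw [lintegral_biUnion_finset hd hs, lintegral_biUnion_finset hd hs, Finset.mul_sum]
  refine Finset.sum_le_sum fun i hi => ?_
  grw [setLIntegral_mono' (hs i hi) (hg i hi), setLIntegral_const, hM i hi, mul_comm]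

/-- Gallagher's form of the large sieve inequality. -/
theorem setLIntegral_norm_sq_le_of_measure_Ioc_le (hf : ∀ y, HasDerivAt f (f' y) y)
    (hf' : Continuous f') {ν : Measure ℝ} {N : ℕ} {h : ℝ} (hh : 0 < h) {M : ℝ≥0∞}
    (hM : ∀ i < N, ν (Ioc (i * h) ((i + 1) * h)) ≤ M) :
    ∫⁻ x in Ioc 0 (N * h), ‖f x‖ₑ ^ 2 ∂ν
      ≤ M * ENNReal.ofReal (∫ y in 0..N * h, (2 * h⁻¹ * ‖f y‖ ^ 2 + h * ‖f' y‖ ^ 2)) := by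
  have hfc : Continuous f := continuous_iff_continuousAt.2 fun y => (hf y).continuousAt
  set Q : ℝ → ℝ := fun y => 2 * h⁻¹ * ‖f y‖ ^ 2 + h * ‖f' y‖ ^ 2
  have hQc : Continuous Q := by fun_prop
  have ofReal_integral_Q {a b : ℝ} (hab : a ≤ b) :
      ENNReal.ofReal (∫ y in a..b, Q y) = ∫⁻ y in Ioc a b, ENNReal.ofReal (Q y) := by
    rw [intervalIntegral.integral_of_le hab, ofReal_integral_eq_lintegral_ofReal
      (hQc.intervalIntegrable a b).1 (ae_of_all _ fun y => by positivity)]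
  let t : ℕ → ℝ := fun i => i * h
  have ht : Monotone t := fun i j hij => by dsimp only [t]; gcongr
  have hcover : ⋃ i ∈ Finset.range N, Ioc (t i) (t (i + 1)) = Ioc 0 (N * h) := by
    simpa [t] using ht.biUnion_Ico_Ioc_map_succ 0 N
  rw [ofReal_integral_Q (by positivity), ← hcover]
  refine setLIntegral_biUnion_le_mul (s := fun i => Ioc (t i) (t (i + 1)))
    (fun i _ => measurableSet_Ioc) (ht.pairwise_disjoint_on_Ioc_succ.set_pairwise _)
    (fun i hi => ?_) (fun i _ x hx => ?_)
  · simpa [t] using hM i (Finset.mem_range.1 hi)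
  · have hlen : t (i + 1) - t i = h := by simp only [t]; push_cast; ring
    have hlt : t i < t (i + 1) := by linarith
    rw [← ofReal_integral_Q hlt.le, ← ofReal_norm, ← ENNReal.ofReal_pow (norm_nonneg _)]
    refine ENNReal.ofReal_le_ofReal ?_
    simpa only [hlen] using norm_sq_le_integral hf hf' hlt (Ioc_subset_Icc_self hx)

end Gallagher

section TrigPoly

open Finset MeasureTheory Real

open scoped ENNReal ComplexConjugate

/-- The trigonometric polynomial `∑ n < N, a n * e ^ (i n x)`. -/
noncomputable def trigPoly (a : ℕ → ℂ) (N : ℕ) (x : ℝ) : ℂ :=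
  ∑ n ∈ range N, a n * Complex.exp (Complex.I * n * x)

theorem continuous_trigPoly (a : ℕ → ℂ) (N : ℕ) : Continuous (trigPoly a N) := by
  unfold trigPoly
  fun_prop

theorem hasDerivAt_trigPoly (a : ℕ → ℂ) (N : ℕ) (x : ℝ) :
    HasDerivAt (trigPoly a N) (trigPoly (fun n => Complex.I * n * a n) N x) x := by
  refine HasDerivAt.fun_sum fun n _ => ?_
  have hlin : HasDerivAt (fun y : ℝ => Complex.I * n * y) (Complex.I * n) x := by
    simpa using (Complex.ofRealCLM.hasDerivAt (x := x)).const_mul (Complex.I * n)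
  exact (hlin.cexp.const_mul (a n)).congr_deriv (by ring)

theorem integral_exp_int_mul (k : ℤ) :
    ∫ x in 0..2 * π, Complex.exp (Complex.I * k * x) = if k = 0 then 2 * (π : ℂ) else 0 := by
  split_ifs with hk
  · simp [hk]
  · have hk' : Complex.I * k ≠ 0 := mul_ne_zero Complex.I_ne_zero (Int.cast_ne_zero.2 hk)
    have hperiod : Complex.I * k * (2 * π : ℝ) = k * (2 * π * Complex.I) := by push_cast; ring
    rw [integral_exp_mul_complex hk', hperiod, Complex.exp_int_mul_two_pi_mul_I]
    simp

theorem ofReal_norm_sq_trigPoly (a : ℕ → ℂ) (N : ℕ) (x : ℝ) :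
    ((‖trigPoly a N x‖ ^ 2 : ℝ) : ℂ)
      = ∑ n ∈ range N, ∑ m ∈ range N,
        conj (a n) * a m * Complex.exp (Complex.I * ((m - n : ℤ) : ℂ) * x) := by
  rw [Complex.ofReal_pow, ← Complex.conj_mul', trigPoly, map_sum, sum_mul_sum]
  refine sum_congr rfl fun n _ => sum_congr rfl fun m _ => ?_
  rw [map_mul, ← Complex.exp_conj, mul_mul_mul_comm, ← Complex.exp_add]
  simp only [map_mul, Complex.conj_I, Complex.conj_ofReal, map_natCast]
  congr 2
  push_cast
  ring

theorem integral_norm_sq_trigPoly (a : ℕ → ℂ) (N : ℕ) :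
    ∫ x in 0..2 * π, ‖trigPoly a N x‖ ^ 2 = 2 * π * ∑ n ∈ range N, ‖a n‖ ^ 2 := by
  apply Complex.ofReal_injective
  rw [← intervalIntegral.integral_ofReal]
  simp_rw [ofReal_norm_sq_trigPoly]
  rw [intervalIntegral.integral_finsetSum fun n _ =>
    Continuous.intervalIntegrable (by fun_prop) _ _]
  rw [Complex.ofReal_mul, Complex.ofReal_sum, mul_sum]
  refine sum_congr rfl fun n hn => ?_
  rw [intervalIntegral.integral_finsetSum fun m _ =>
    Continuous.intervalIntegrable (by fun_prop) _ _]
  have diagonal (m : ℕ) : (m - n : ℤ) = 0 ↔ n = m := by omega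
  simp_rw [intervalIntegral.integral_const_mul, integral_exp_int_mul, diagonal, mul_ite, mul_zero]
  rw [sum_ite_eq, if_pos hn, Complex.conj_mul', mul_comm]
  push_cast
  rfl

theorem sum_norm_sq_deriv_coeff_le (a : ℕ → ℂ) (N : ℕ) :
    ∑ n ∈ range N, ‖Complex.I * n * a n‖ ^ 2 ≤ (N : ℝ) ^ 2 * ∑ n ∈ range N, ‖a n‖ ^ 2 := by
  rw [mul_sum]
  refine sum_le_sum fun n hn => ?_
  have hnN : (n : ℝ) ≤ N := mod_cast (mem_range.1 hn).le
  rw [norm_mul, mul_pow, norm_mul, Complex.norm_I, one_mul, Complex.norm_natCast]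
  gcongr

theorem setLIntegral_norm_sq_trigPoly_le (a : ℕ → ℂ) {N : ℕ} (hN : 0 < N) {ν : Measure ℝ}
    {M : ℝ≥0∞} (hM : ∀ i < N, ν (Set.Ioc (i * (2 * π / N)) ((i + 1) * (2 * π / N))) ≤ M) :
    ∫⁻ x in Set.Ioc 0 (2 * π), ‖trigPoly a N x‖ₑ ^ 2 ∂ν
      ≤ M * ENNReal.ofReal ((2 + 4 * π ^ 2) * N * ∑ n ∈ range N, ‖a n‖ ^ 2) := by
  have hN' : (0 : ℝ) < N := Nat.cast_pos.2 hN
  have hf := continuous_trigPoly a N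
  have hf' := continuous_trigPoly (fun n => Complex.I * n * a n) N
  have hsieve := setLIntegral_norm_sq_le_of_measure_Ioc_le (hasDerivAt_trigPoly a N) hf'
    (by positivity) hM
  rw [mul_div_cancel₀ _ hN'.ne', intervalIntegral.integral_add
    (Continuous.intervalIntegrable (by fun_prop) _ _)
    (Continuous.intervalIntegrable (by fun_prop) _ _), intervalIntegral.integral_const_mul,
    intervalIntegral.integral_const_mul, integral_norm_sq_trigPoly,
    integral_norm_sq_trigPoly] at hsieve
  grw [hsieve, sum_norm_sq_deriv_coeff_le]
  refine le_of_eq ?_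
  congr 2
  field_simp
  ring

theorem setLIntegral_norm_sq_trigPoly_le_of_holder (a : ℕ → ℂ) {N : ℕ} (hN : 0 < N)
    {ν : Measure ℝ} {D : ℝ} (hD : 0 ≤ D) {C : NNReal}
    (hν : ∀ x y, ν (Set.Ioc x y) ≤ C * ENNReal.ofReal (y - x) ^ D) :
    ∫⁻ x in Set.Ioc 0 (2 * π), ‖trigPoly a N x‖ₑ ^ 2 ∂ν
      ≤ ENNReal.ofReal (C * (2 * π) ^ D * (2 + 4 * π ^ 2) * (N : ℝ) ^ (1 - D)
        * ∑ n ∈ range N, ‖a n‖ ^ 2) := by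
  have hN' : (0 : ℝ) < N := Nat.cast_pos.2 hN
  have hcell : ∀ i < N, ν (Set.Ioc (i * (2 * π / N)) ((i + 1) * (2 * π / N)))
      ≤ ENNReal.ofReal (C * (2 * π / N) ^ D) := by
    intro i _
    rw [ENNReal.ofReal_mul C.coe_nonneg, ENNReal.ofReal_coe_nnreal,
      ← ENNReal.ofReal_rpow_of_nonneg (by positivity) hD]
    convert hν _ _ using 4
    ring
  refine (setLIntegral_norm_sq_trigPoly_le a hN hcell).trans (le_of_eq ?_)
  rw [← ENNReal.ofReal_mul (by positivity), div_rpow (by positivity) hN'.le, rpow_sub hN', rpow_one]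
  congr 1
  ring

end TrigPoly

section Summability

open Finset MeasureTheory

open scoped ENNReal

theorem ae_summable_of_lintegral_le {X : Type*} [MeasurableSpace X] {μ : Measure X}
    {g : ℕ → X → ℝ} (hg : ∀ k, Measurable (g k)) (hg₀ : ∀ k x, 0 ≤ g k x) {b : ℕ → ℝ}
    (h : ∀ k, ∫⁻ x, ENNReal.ofReal (g k x) ∂μ ≤ ENNReal.ofReal (b k)) (hb : Summable b) :
    ∀ᵐ x ∂μ, Summable fun k => g k x := by
  have hfin : ∫⁻ x, ∑' k, ENNReal.ofReal (g k x) ∂μ ≠ ⊤ := by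
    rw [lintegral_tsum fun k => (hg k).ennreal_ofReal.aemeasurable]
    exact ne_top_of_le_ne_top hb.tsum_ofReal_ne_top (ENNReal.tsum_le_tsum h)
  filter_upwards [ae_lt_top (Measurable.tsum fun k => (hg k).ennreal_ofReal) hfin] with x hx
  exact (ENNReal.summable_toReal hx.ne).congr fun k => ENNReal.toReal_ofReal (hg₀ k x)

theorem summable_sqrt_mul {a b : ℕ → ℝ} (ha₀ : ∀ k, 0 ≤ a k) (hb₀ : ∀ k, 0 ≤ b k)
    (ha : Summable a) (hb : Summable b) : Summable fun k => √(a k * b k) := by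
  refine (ha.add hb).of_nonneg_of_le (fun k => Real.sqrt_nonneg _) fun k => ?_
  rw [Real.sqrt_le_left (add_nonneg (ha₀ k) (hb₀ k))]
  nlinarith [mul_nonneg (ha₀ k) (hb₀ k), sq_nonneg (a k), sq_nonneg (b k)]

theorem summable_sum_Ico_two_pow {f : ℕ → ℝ} (hf₀ : ∀ n, 0 ≤ f n) (hf : Summable f) :
    Summable fun k => ∑ i ∈ Ico (2 ^ k) (2 ^ k + 2 ^ k), f i := by
  refine summable_of_sum_range_le (c := ∑' n, f n) (fun k => sum_nonneg fun i _ => hf₀ i)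
    fun n => ?_
  have htelescope : ∑ k ∈ range n, ∑ i ∈ Ico (2 ^ k) (2 ^ k + 2 ^ k), f i
      = ∑ i ∈ Ico 1 (2 ^ n), f i := by
    induction n with
    | zero => simp
    | succ n ih =>
      rw [sum_range_succ, ih, sum_Ico_consecutive _ Nat.one_le_two_pow (Nat.le_add_left _ _),
        pow_succ, mul_two]
  exact htelescope ▸ hf.sum_le_tsum _ fun i _ => hf₀ i

theorem summable_two_pow_rpow_mul_sum_Ico {γ : ℝ} (hγ : 0 ≤ γ) {u : ℕ → ℝ} (hu : ∀ n, 0 ≤ u n)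
    (h : Summable fun n : ℕ => (n : ℝ) ^ γ * u n) :
    Summable fun k : ℕ => ((2 : ℝ) ^ k) ^ γ * ∑ i ∈ Ico (2 ^ k) (2 ^ k + 2 ^ k), u i := by
  refine (summable_sum_Ico_two_pow (fun n => mul_nonneg (by positivity) (hu n)) h).of_nonneg_of_le
    (fun k => mul_nonneg (by positivity) (sum_nonneg fun i _ => hu i)) fun k => ?_
  rw [mul_sum]
  refine sum_le_sum fun i hi => mul_le_mul_of_nonneg_right ?_ (hu i)
  gcongr
  exact_mod_cast (mem_Ico.1 hi).1

theorem summable_add_one_pow_mul_geometric {r : ℝ} (hr₀ : 0 ≤ r) (hr₁ : r < 1) (d : ℕ) :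
    Summable fun k : ℕ => ((k : ℝ) + 1) ^ d * r ^ k := by
  rcases hr₀.eq_or_lt with rfl | hr₀
  · exact summable_of_ne_finset_zero (s := {0}) fun k hk => by
      rw [zero_pow (by simpa only [mem_singleton] using hk), mul_zero]
  · have hgeom : Summable fun k : ℕ => (k : ℝ) ^ d * r ^ k :=
      summable_pow_mul_geometric_of_norm_lt_one d (by rwa [Real.norm_of_nonneg hr₀.le])
    refine (((summable_nat_add_iff 1).2 hgeom).mul_left r⁻¹).congr fun k => ?_
    rw [pow_succ']
    push_cast
    field_simp

/-- Cauchy–Schwarz with the weights `(k + 1) * r ^ k`, `r = 2 ^ (θ - γ) < 1`, trades the gap between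
`θ` and `γ` for the square root and the polynomial factors. -/
theorem ae_summable_add_one_mul_sqrt_dyadicEnergy {X M : Type*} [MeasurableSpace X]
    {μ : Measure X} [SeminormedAddCommGroup M] {B : X → ℕ → M}
    (hB : ∀ n, StronglyMeasurable fun x => B x n) {u : ℕ → ℝ} (hu : ∀ n, 0 ≤ u n) {γ θ K : ℝ}
    (hγ : 0 ≤ γ) (hθγ : θ < γ) (hsum : Summable fun n : ℕ => (n : ℝ) ^ γ * u n)
    (hE : ∀ k : ℕ, ∫⁻ x, ENNReal.ofReal (dyadicEnergy (B x) k (2 ^ k)) ∂μ ≤ ENNReal.ofReal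
      ((k + 1) * (K * ((2 : ℝ) ^ k) ^ θ * ∑ i ∈ Ico (2 ^ k) (2 ^ k + 2 ^ k), u i))) :
    ∀ᵐ x ∂μ, Summable fun k : ℕ => ((k : ℝ) + 1) * √(dyadicEnergy (B x) k (2 ^ k)) := by
  set r : ℝ := 2 ^ (θ - γ)
  have hr₀ : 0 < r := by positivity
  have hr₁ : r < 1 := Real.rpow_lt_one_of_one_lt_of_neg one_lt_two (by linarith)
  have hpow (k : ℕ) : ((2 : ℝ) ^ k) ^ θ = r ^ k * ((2 : ℝ) ^ k) ^ γ := by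
    rw [← Real.rpow_pow_comm zero_le_two, ← Real.rpow_pow_comm zero_le_two, ← mul_pow,
      ← Real.rpow_add two_pos, sub_add_cancel]
  have hweighted : ∀ᵐ x ∂μ, Summable fun k : ℕ =>
      (((k : ℝ) + 1) * r ^ k)⁻¹ * dyadicEnergy (B x) k (2 ^ k) := by
    refine ae_summable_of_lintegral_le
      (g := fun k x => (((k : ℝ) + 1) * r ^ k)⁻¹ * dyadicEnergy (B x) k (2 ^ k))
      (fun k => (measurable_dyadicEnergy hB k (2 ^ k)).const_mul _)
      (fun k x => mul_nonneg (by positivity) (dyadicEnergy_nonneg (B x) k (2 ^ k))) (fun k => ?_)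
      ((summable_two_pow_rpow_mul_sum_Ico hγ hu hsum).mul_left K)
    have hc : 0 ≤ (((k : ℝ) + 1) * r ^ k)⁻¹ := by positivity
    simp only [ENNReal.ofReal_mul hc]
    rw [lintegral_const_mul _ (measurable_dyadicEnergy hB _ _).ennreal_ofReal]
    grw [hE k]
    rw [← ENNReal.ofReal_mul hc, hpow]
    refine ENNReal.ofReal_le_ofReal (le_of_eq ?_)
    field_simp
  filter_upwards [hweighted] with x hx
  refine (summable_sqrt_mul (fun k => by positivity)
    (fun k => mul_nonneg (by positivity) (dyadicEnergy_nonneg _ _ _))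
    (summable_add_one_pow_mul_geometric hr₀.le hr₁ 3) hx).congr fun k => ?_
  have hprod : ((k : ℝ) + 1) ^ 3 * r ^ k
      * ((((k : ℝ) + 1) * r ^ k)⁻¹ * dyadicEnergy (B x) k (2 ^ k))
      = ((k : ℝ) + 1) ^ 2 * dyadicEnergy (B x) k (2 ^ k) := by
    field_simp
  rw [hprod, Real.sqrt_mul (sq_nonneg _), Real.sqrt_sq (by positivity)]

end Summability

section Main

open Finset MeasureTheory Real

open scoped ENNReal

theorem norm_sum_Ico_pruferStep_eq_norm_trigPoly (α : ℕ → ℂ) (η : ℝ) (s N : ℕ) :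
    ‖∑ i ∈ Ico s (s + N), pruferStep α (Complex.exp (Complex.I * η)) i‖
      = ‖trigPoly (fun n => α (s + n)) N η‖ := by
  have hfactor : ∑ i ∈ Ico s (s + N), α i * Complex.exp (Complex.I * η) ^ (i + 1)
      = Complex.exp (Complex.I * η) ^ (s + 1) * trigPoly (fun n => α (s + n)) N η := by
    rw [sum_Ico_eq_sum_range, Nat.add_sub_cancel_left, trigPoly, mul_sum]
    refine sum_congr rfl fun n _ => ?_
    have hexp : Complex.exp (Complex.I * n * η) = Complex.exp (Complex.I * η) ^ n := by
      rw [← Complex.exp_nat_mul]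
      ring_nf
    rw [hexp]
    ring
  rw [norm_sum_pruferStep, hfactor, norm_mul, norm_pow, Complex.norm_exp_I_mul_ofReal, one_pow,
    one_mul]

theorem continuous_pruferStep (α : ℕ → ℂ) (n : ℕ) :
    Continuous fun η : ℝ => pruferStep α (Complex.exp (Complex.I * η)) n := by
  unfold pruferStep
  fun_prop

theorem exists_lintegral_dyadicEnergy_pruferStep_le (α : ℕ → ℂ) {ν : Measure ℝ} {D : ℝ}
    (hD₀ : 0 ≤ D) (hD₁ : D ≤ 1) {C : NNReal}
    (hν : ∀ x y, ν (Set.Ioc x y) ≤ C * ENNReal.ofReal (y - x) ^ D) :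
    ∃ K : ℝ, ∀ m s : ℕ, ∫⁻ η in Set.Ioc 0 (2 * π),
        ENNReal.ofReal (dyadicEnergy (pruferStep α (Complex.exp (Complex.I * η))) m s) ∂ν
      ≤ ENNReal.ofReal
        ((m + 1) * (K * ((2 : ℝ) ^ m) ^ (1 - D) * ∑ i ∈ Ico s (s + 2 ^ m), ‖α i‖ ^ 2)) := by
  set K : ℝ := C * (2 * π) ^ D * (2 + 4 * π ^ 2)
  have hblock (m : ℕ) : ∀ i ≤ m, ∀ s, ∫⁻ η in Set.Ioc 0 (2 * π),
        ‖∑ j ∈ Ico s (s + 2 ^ i), pruferStep α (Complex.exp (Complex.I * η)) j‖ₑ ^ 2 ∂ν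
      ≤ ENNReal.ofReal (K * ((2 : ℝ) ^ m) ^ (1 - D))
        * ∑ j ∈ Ico s (s + 2 ^ i), ENNReal.ofReal (‖α j‖ ^ 2) := by
    intro i hi s
    have hsieve := setLIntegral_norm_sq_trigPoly_le_of_holder (fun n => α (s + n))
      (Nat.two_pow_pos i) hD₀ hν
    simp only [← ofReal_norm, norm_sum_Ico_pruferStep_eq_norm_trigPoly] at hsieve ⊢
    refine hsieve.trans ?_
    rw [← ENNReal.ofReal_sum_of_nonneg fun j _ => sq_nonneg _, ← ENNReal.ofReal_mul (by positivity),
      sum_Ico_eq_sum_range, Nat.add_sub_cancel_left]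
    push_cast
    gcongr
    linarith
  refine ⟨K, fun m s => ?_⟩
  refine (lintegral_dyadicEnergy_le (fun n => (continuous_pruferStep α n).stronglyMeasurable) m
    (hblock m) s).trans (le_of_eq ?_)
  have hcast : (m : ℝ≥0∞) + 1 = ENNReal.ofReal (m + 1) := by
    rw [ENNReal.ofReal_add m.cast_nonneg zero_le_one, ENNReal.ofReal_natCast, ENNReal.ofReal_one]
  rw [hcast, ← ENNReal.ofReal_sum_of_nonneg fun j _ => sq_nonneg _,
    ← ENNReal.ofReal_mul (by positivity), ← ENNReal.ofReal_mul (by positivity)]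

theorem measure_Ioc_le_of_holder {ν : Measure ℝ} {U : Set ℝ} (hU : U.OrdConnected)
    (hνU : ν Uᶜ = 0) {D : ℝ} (hD : 0 ≤ D) {C : NNReal}
    (hν : ∀ I : Set ℝ, I.OrdConnected → I ⊆ U → ν I ≤ C * volume I ^ D) (x y : ℝ) :
    ν (Set.Ioc x y) ≤ C * ENNReal.ofReal (y - x) ^ D := by
  rw [← measure_inter_conull hνU, ← Real.volume_Ioc]
  grw [hν _ (Set.ordConnected_Ioc.inter hU) Set.inter_subset_right, Set.inter_subset_left]

theorem ae_bddAbove_norm_orderedProd_pruferStep {γ : ℝ} {α : ℕ → ℂ}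
    (hα : Summable fun n : ℕ => (n : ℝ) ^ γ * ‖α n‖ ^ 2) {ν : Measure ℝ} {D : ℝ}
    (hD₀ : 0 ≤ D) (hD₁ : D ≤ 1) (hγD : 1 - γ < D) {C : NNReal}
    (hν : ∀ x y, ν (Set.Ioc x y) ≤ C * ENNReal.ofReal (y - x) ^ D) :
    ∀ᵐ η : ℝ ∂ν.restrict (Set.Ioc 0 (2 * π)), BddAbove
      (Set.range fun n => ‖orderedProd (pruferStep α (Complex.exp (Complex.I * η))) 0 n‖) := by
  obtain ⟨K, hK⟩ := exists_lintegral_dyadicEnergy_pruferStep_le α hD₀ hD₁ hν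
  have hsummable := ae_summable_add_one_mul_sqrt_dyadicEnergy
    (fun n => (continuous_pruferStep α n).stronglyMeasurable) (fun n => sq_nonneg ‖α n‖)
    (by linarith) (by linarith : 1 - D < γ) hα fun k => hK k (2 ^ k)
  exact hsummable.mono fun η hη => bddAbove_norm_orderedProd _ hη

end Main

end OPUC

theorem proposition4p3_general {γ : ℝ} {α : ℕ → ℂ}
    (hα_sum : Summable (fun n : ℕ => (n : ℝ) ^ γ * ‖α n‖ ^ 2))
    {ν : MeasureTheory.Measure ℝ} (hν_supp : ν (Set.Ioo 0 (2 * Real.pi))ᶜ = 0)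
    {D : ℝ} (hD : D ∈ Set.Icc 0 1) (hγD : 1 - γ < D) {C : NNReal}
    (hν_holder : ∀ I : Set ℝ, I.OrdConnected → I ⊆ Set.Ioo 0 (2 * Real.pi) →
      ν I ≤ (C : ENNReal) * MeasureTheory.volume I ^ D) :
    ∀ᵐ η ∂ν, BddAbove {r : ℝ | ∃ (β : ℝ) (n : ℕ), r = OPUC.pruferRadius α n η β} := by
  have hIoc : ∀ᵐ η ∂ν, η ∈ Set.Ioc 0 (2 * Real.pi) :=
    MeasureTheory.measure_mono_null (Set.compl_subset_compl.2 Set.Ioo_subset_Ioc_self) hν_supp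
  have hbdd := OPUC.ae_bddAbove_norm_orderedProd_pruferStep hα_sum hD.1 hD.2 hγD
    (OPUC.measure_Ioc_le_of_holder Set.ordConnected_Ioo hν_supp hD.1 hν_holder)
  rw [MeasureTheory.Measure.restrict_eq_self_of_ae_mem hIoc] at hbdd
  filter_upwards [hbdd] with η ⟨c, hc⟩
  refine ⟨c, ?_⟩
  rintro r ⟨β, n, rfl⟩
  exact (OPUC.pruferRadius_le_norm_orderedProd α n η β).trans (hc ⟨n, rfl⟩)

theorem proposition4p3
    (γ : ℝ) (hγ : γ ∈ Set.Ioo (0 : ℝ) 1)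
    (α : ℕ → ℂ) (hα : ∀ n, ‖α n‖ < 1)
    (hα_supp : {n | α n ≠ 0}.Infinite)
    (hα_sum : Summable (fun n : ℕ => (n : ℝ) ^ γ * ‖α n‖ ^ 2))
    (ν : MeasureTheory.Measure ℝ) [MeasureTheory.IsFiniteMeasure ν]
    (hν_supp : ∃ δ : ℝ, 0 < δ ∧ ν (Set.Ioo δ (2 * Real.pi - δ))ᶜ = 0)
    (hν_holder : ∃ D ∈ Set.Ioo (1 - γ) 1, ∃ C : NNReal,
      ∀ I : Set ℝ, I.OrdConnected → I ⊆ Set.Ioo 0 (2 * Real.pi) →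
        ν I ≤ (C : ENNReal) * MeasureTheory.volume I ^ D) :
    ∀ᵐ η ∂ν, BddAbove {r : ℝ | ∃ β ∈ Set.Ico (0 : ℝ) (2 * Real.pi), ∃ n : ℕ,
      r = OPUC.pruferRadius α (OPUC.blockEndpoint α n) η β} := by
  obtain ⟨δ, hδ, hν⟩ := hν_supp
  obtain ⟨D, hD, C, hC⟩ := hν_holder
  have hν₀ : ν (Set.Ioo 0 (2 * Real.pi))ᶜ = 0 := MeasureTheory.measure_mono_null
    (Set.compl_subset_compl.2 (Set.Ioo_subset_Ioo hδ.le (by linarith))) hν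
  have hD₀ : 0 ≤ D := by linarith [hD.1, hγ.2]
  filter_upwards [proposition4p3_general hα_sum hν₀ ⟨hD₀, hD.2.le⟩ hD.1 hC] with η hη
  refine hη.mono ?_
  rintro r ⟨β, -, n, rfl⟩
  exact ⟨β, _, rfl⟩
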